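/- **Theorem 3.** Let $\|\cdot\|$ be the norm of $L^2(0,1)$, $|\cdot|$ the Euclidean norm, $s^+=\max(s,0)$, $\mathbb{R}_+=[0,+\infty)$, and let $\|\cdot\|_\infty$ be the essential supremum norm on $\mathbb{R}_+$. Let $\varepsilon,\Gamma>0$, $c\ge 1$, $b\ge 1\ge a>0$ and $p>0$ be constants, let $K:[0,1]\times\mathbb{R}\to\mathbb{R}$ be a function and $L:H^2(0,1)\cap H_0^1(0,1)\to\mathbb{R}$ a (not necessarily linear) functional with $$|K(x,y)|\le |y|,\qquad |L(v)|\le \|v\|\qquad\text{for all } x\in[0,1],\ y\in\mathbb{R},\ v\in H^2(0,1)\cap H_0^1(0,1),$$ and let $d\in L^\infty(\mathbb{R}_+)$ and $\theta=(\theta_1,\theta_2)\in C^0(\mathbb{R}_+;\mathbb{R}^2)\cap L^\infty(\mathbb{R}_+;\mathbb{R}^2)$. Let $$w\in C^0(\mathbb{R}_+;L^2(0,1))\cap C^1((0,+\infty);L^2(0,1))\cap C^0((0,+\infty);H^2(0,1)\cap H_0^1(0,1)),\qquad z\in C^1(\mathbb{R}_+),\qquad y\in C^0(\mathbb{R}_+),$$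 with $y$ absolutely continuous on every compact interval of $\mathbb{R}_+$, be a solution of the closed-loop system $$w_t[t]=p\,w_{xx}[t]+\theta_1(t)K(\cdot,y(t)) \text{ in } L^2(0,1)\quad\text{and}\quad \dot z(t)=\Gamma e^{-z(t)}\Big(\tfrac{y^2(t)}{2}-\varepsilon\Big)^+\quad\text{for all } t>0,$$ $$\dot y(t)=u(t)+\theta_2(t)L(w[t])+d(t)\quad\text{for almost all } t>0,$$ where $$u(t)=-c\left(1+\frac{(b+e^{z(t)})^7}{4a^6}\right)\left(y^7(t)+y^3(t)+y(t)\right).$$ Set $$\kappa=\min\Big(\frac{p\pi^2}{2},2c\Big),\quad \bar K=\frac{4p\pi^2(b\kappa+ap\pi^2)+2b\kappa p^2\pi^4+b}{4p\pi^2b\kappa},\quad \bar B=\frac{a\bar K(\varepsilon\Gamma+2c)+\varepsilon c\Gamma}{4c^2\varepsilon}.$$ Then for all $t\ge 0$ $$\|w[t]\|^2+y^2(t)\le e^{-\kappa t}\left(\|w[0]\|^2+y^2(0)\right)+2a\,\frac{\|d\|_\infty^2+\|\theta\|_\infty^8+2p^{-2}}{b\kappa}+\frac{\|\theta\|_\infty^4}{2p^2\pi^4\kappa},$$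 $$z(0)\le z(t)\le\ln\left(e^{z(0)}+\bar B\left(\|d\|_\infty^2+\|\theta\|_\infty^4+\|\theta\|_\infty^8+2p^{-2}+\|w[0]\|^2+y^2(0)\right)\right),$$ and moreover $$\limsup_{t\to+\infty}\|w[t]\|\le\frac{\sqrt{2\varepsilon}}{p\pi^2}\limsup_{t\to+\infty}|\theta_1(t)|,\qquad \limsup_{t\to+\infty}|y(t)|\le\sqrt{2\varepsilon}.$$ -/

import Mathlib

open MeasureTheory Filter Set Topology
open scoped ENNReal ContDiff

namespace DADS

/-- Lebesgue measure on the open interval `(0, 1)`. -/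
noncomputable def unitMeasure : Measure ℝ := volume.restrict (Ioo (0 : ℝ) 1)

/-- The Hilbert space `L²(0, 1)`. -/
abbrev L2 : Type := Lp ℝ 2 unitMeasure

/-- `g` is the weak derivative of `f` on `(0, 1)`: for every test function `φ ∈ C_c^∞(0, 1)`
one has `∫ f φ' = - ∫ g φ`. -/
def IsWeakDeriv (f g : L2) : Prop :=
  ∀ φ : ℝ → ℝ, ContDiff ℝ ∞ φ → HasCompactSupport φ → tsupport φ ⊆ Ioo (0 : ℝ) 1 →
    ∫ x, f x * deriv φ x ∂unitMeasure = - ∫ x, g x * φ x ∂unitMeasure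

/-- Weak derivatives are unique, so that the pairs and triples below stand for functions. -/
theorem IsWeakDeriv.unique {f g h : L2} (hg : IsWeakDeriv f g) (hh : IsWeakDeriv f h) : g = h := by
  haveI : IsFiniteMeasure unitMeasure := by unfold unitMeasure; infer_instance
  apply Lp.ext
  have int : ∀ f : L2, Integrable f unitMeasure := fun f =>
    (Lp.memLp f).integrable (by norm_num)
  have := IsOpen.ae_eq_zero_of_integral_contDiff_smul_eq_zero (μ := volume) (U := Ioo (0:ℝ) 1)
    (f := fun x => g x - h x) isOpen_Ioo
    (by
      have : IntegrableOn (fun x => g x - h x) (Ioo 0 1) volume := by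
        rw [IntegrableOn]; exact (int g).sub (int h)
      exact this.locallyIntegrableOn) (by
    intro φ h1 h2 h3
    have e := (hg φ h1 h2 h3).symm.trans (hh φ h1 h2 h3)
    have ig : ∀ f : L2, Integrable (fun x => f x * φ x) unitMeasure := fun f => by
      obtain ⟨C, hC⟩ := h2.exists_bound_of_continuous h1.continuous
      exact (int f).mul_bdd (c := C) h1.continuous.aestronglyMeasurable (Eventually.of_forall hC)
    have e2 : ∫ x, φ x • (g x - h x) ∂unitMeasure = 0 := by
      simp only [smul_eq_mul, mul_comm (φ _), sub_mul]
      rw [integral_sub (ig g) (ig h)]; linarith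
    rw [← setIntegral_eq_integral_of_forall_compl_eq_zero (s := Ioo (0:ℝ) 1)]
    · exact e2
    · intro x hx
      have : φ x = 0 := image_eq_zero_of_notMem_tsupport (fun h => hx (h3 h))
      simp [this])
  have h2 := (ae_restrict_iff' measurableSet_Ioo).2 this
  filter_upwards [h2] with x hx
  linarith
/-- The Sobolev space `H¹(0, 1)`. A function `f` is recorded together with its (unique) weak
derivative as the pair `(f, f')`; the topology induced by `L² × L²` is that of the `H¹` norm. -/
def H1 : Set (L2 × L2) := {q | IsWeakDeriv q.1 q.2}

/-- The pairs `(φ, φ')` for `φ` of class `C¹` with compact support in `(0, 1)`. -/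
def C1Compact : Set (L2 × L2) :=
  {q | ∃ φ : ℝ → ℝ, ContDiff ℝ 1 φ ∧ HasCompactSupport φ ∧ tsupport φ ⊆ Ioo (0 : ℝ) 1 ∧
    (∀ᵐ x ∂unitMeasure, q.1 x = φ x) ∧ (∀ᵐ x ∂unitMeasure, q.2 x = deriv φ x)}

/-- The space `H₀¹(0, 1)`: the closure in `H¹(0, 1)` of the compactly supported `C¹` functions. -/
def H10 : Set (L2 × L2) := H1 ∩ closure C1Compact

/-- The space `H²(0, 1) ∩ H₀¹(0, 1)`. A function `f` is recorded together with its (unique) weak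
derivatives as the triple `(f, f', f'')`; the topology induced by `L² × L² × L²` is that of the
`H²` norm. -/
def H2H10 : Set (L2 × L2 × L2) :=
  {q | (q.1, q.2.1) ∈ H10 ∧ (q.2.1, q.2.2) ∈ H1}

/-- The element of `L²(0, 1)` underlying an element of `H² ∩ H₀¹`. -/
def H2H10.toL2 (q : H2H10) : L2 := (q : L2 × L2 × L2).1

/-- The second weak derivative of an element of `H² ∩ H₀¹`. -/
def H2H10.dxx (q : H2H10) : L2 := (q : L2 × L2 × L2).2.2

/-- The norm `‖f‖_∞` of `L^∞(ℝ₊; E)`, as a real number. -/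
noncomputable def supNorm {E : Type*} [NormedAddCommGroup E] (f : ℝ → E) : ℝ :=
  (eLpNorm f ∞ (volume.restrict (Ici (0 : ℝ)))).toReal

/-- The feedback law `u`, as a function of the measured state `y` and the gain `z`. -/
noncomputable def feedback (a b c y z : ℝ) : ℝ :=
  -c * (1 + (b + Real.exp z) ^ 7 / (4 * a ^ 6)) * (y ^ 7 + y ^ 3 + y)

/-- The right-hand side of the update law of the gain `z`, with `V(y) = y² / 2`. -/
noncomputable def update (ε Γ y z : ℝ) : ℝ :=
  Γ * Real.exp (-z) * max (y ^ 2 / 2 - ε) 0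

/-- `(w, y, z)` is a solution on `[0, ∞)`, in the regularity class of the theorem, of the
closed-loop system
`w_t = p w_xx + θ₁ K(x, y)`, `w(0) = w(1) = 0`, `y' = u + θ₂ L(w) + d`, `u` the feedback law,
`z' = Γ e^{-z} (V(y) - ε)⁺`. The function `W` is the curve `w` on `(0, ∞)`, seen as a curve in
`H² ∩ H₀¹`. The components `θ₁, θ₂` of `θ` are `θ t 0` and `θ t 1`. -/
structure IsSolution (ε Γ a b c p : ℝ) (K : ℝ → ℝ → ℝ) (L : H2H10 → ℝ)
    (d : ℝ → ℝ) (θ : ℝ → EuclideanSpace ℝ (Fin 2))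
    (w : ℝ → L2) (W : ℝ → H2H10) (y z : ℝ → ℝ) : Prop where
  w_continuous : ContinuousOn w (Ici 0)
  w_contDiff : ContDiffOn ℝ 1 w (Ioi 0)
  W_eq : ∀ t > 0, H2H10.toL2 (W t) = w t
  W_continuous : ContinuousOn W (Ioi 0)
  z_contDiff : ContDiffOn ℝ 1 z (Ici 0)
  y_continuous : ContinuousOn y (Ici 0)
  y_absCont : ∀ s t : ℝ, 0 ≤ s → s ≤ t → AbsolutelyContinuousOnInterval y s t
  w_eqn : ∀ t > 0, ∀ᵐ x ∂unitMeasure,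
    deriv w t x = p * H2H10.dxx (W t) x + θ t 0 * K x (y t)
  z_eqn : ∀ t > 0, HasDerivAt z (update ε Γ (y t) (z t)) t
  y_eqn : ∀ᵐ t ∂(volume.restrict (Ioi (0 : ℝ))),
    HasDerivAt y (feedback a b c (y t) (z t) + θ t 1 * L (W t) + d t) t

/-- The decay rate `κ`. -/
noncomputable def kappa (p c : ℝ) : ℝ := min (p * Real.pi ^ 2 / 2) (2 * c)

/-- The constant `K̄`. -/
noncomputable def Kbar (a b c p : ℝ) : ℝ :=
  (4 * p * Real.pi ^ 2 * (b * kappa p c + a * p * Real.pi ^ 2)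
      + 2 * b * kappa p c * p ^ 2 * Real.pi ^ 4 + b)
    / (4 * p * Real.pi ^ 2 * b * kappa p c)

/-- The constant `B̄`. -/
noncomputable def Bbar (ε Γ a b c p : ℝ) : ℝ :=
  (a * Kbar a b c p * (ε * Γ + 2 * c) + ε * c * Γ) / (4 * c ^ 2 * ε)

end DADS

/-!
Weak derivatives are tested against `C_c^∞`, while `H₀¹` is the closure of `C_c^1`; mollification
reconciles the two, so integration by parts and the Wirtinger inequality give
`⟪v, v_xx⟫ ≤ -π² ‖v‖²`. The loop thus reduces to scalar differential inequalities in `X = ‖w‖`,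
`y` and `z`.

With `r = (b + e^z) / a ≥ 1`, the degree-seven feedback absorbs both coupling terms by Young's
inequality at the cost of a constant over `r`. As `r ≥ b / a`, Grönwall's inequality gives the
energy estimate, hence also `dV/dt ≤ -2c V + Q / e^z` for `V = y² / 2` and a constant `Q`. Once
`e^z` exceeds `Q / (2cε)`, the quantity `e^z + Γ / (2c) (V - ε)⁺` is nonincreasing, which bounds
`z`. Now the derivative `Γ (V - ε)⁺` of `e^z` is integrable and `V` grows at most linearly, so
`(V - ε)⁺ → 0` by a one-sided Barbălat lemma. This bounds `limsup |y|`, and comparison in the heat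
energy inequality bounds `limsup ‖w‖`.
-/

namespace DADS

section Mollification

open scoped Convolution Pointwise

variable {F : Type*} [NormedAddCommGroup F] [NormedSpace ℝ F]

theorem tsupport_normed_convolution_subset (ρ : ContDiffBump (0 : ℝ)) (φ : ℝ → F) :
    tsupport (ρ.normed volume ⋆[ContinuousLinearMap.lsmul ℝ ℝ, volume] φ) ⊆
      Metric.cthickening ρ.rOut (tsupport φ) := by
  refine closure_minimal ?_ Metric.isClosed_cthickening
  refine (support_convolution_subset (ContinuousLinearMap.lsmul ℝ ℝ)).trans ?_
  rw [ρ.support_normed_eq, ball_add, zero_vadd ℝ]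
  exact (Metric.thickening_subset_of_subset _ (subset_tsupport φ)).trans
    (Metric.thickening_subset_cthickening _ _)

theorem exists_contDiff_dist_le_dist_deriv_le [CompleteSpace F] {φ : ℝ → F} {U : Set ℝ}
    (hU : IsOpen U) (hφ : ContDiff ℝ 1 φ) (hc : HasCompactSupport φ) (hφU : tsupport φ ⊆ U)
    {η : ℝ} (hη : 0 < η) :
    ∃ ψ : ℝ → F, ContDiff ℝ ∞ ψ ∧ HasCompactSupport ψ ∧ tsupport ψ ⊆ U ∧
      (∀ x, dist (ψ x) (φ x) ≤ η) ∧ ∀ x, dist (deriv ψ x) (deriv φ x) ≤ η := by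
  have hφ' : Continuous (deriv φ) := hφ.continuous_deriv le_rfl
  obtain ⟨δ₀, hδ₀, hδ₀U⟩ := hc.isCompact.exists_cthickening_subset_open hU hφU
  obtain ⟨δ₁, hδ₁, hφδ⟩ := Metric.uniformContinuous_iff.1
    (hc.uniformContinuous_of_continuous hφ.continuous) η hη
  obtain ⟨δ₂, hδ₂, hφ'δ⟩ := Metric.uniformContinuous_iff.1
    (hc.deriv.uniformContinuous_of_continuous hφ') η hη
  obtain ⟨δ, hδ, hδ_lt⟩ := exists_between (lt_min hδ₀ (lt_min hδ₁ hδ₂))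
  simp only [lt_min_iff] at hδ_lt
  let ρ : ContDiffBump (0 : ℝ) := ⟨δ / 2, δ, half_pos hδ, half_lt_self hδ⟩
  have hsupp := (tsupport_normed_convolution_subset ρ φ).trans
    (Metric.cthickening_mono hδ_lt.1.le _)
  refine ⟨ρ.normed volume ⋆[ContinuousLinearMap.lsmul ℝ ℝ, volume] φ,
    ρ.hasCompactSupport_normed.contDiff_convolution_left _ ρ.contDiff_normed
      hφ.continuous.locallyIntegrable,
    hc.isCompact.cthickening.of_isClosed_subset isClosed_closure hsupp, hsupp.trans hδ₀U,
    fun x ↦ ?_, fun x ↦ ?_⟩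
  · exact ρ.dist_normed_convolution_le hφ.continuous.aestronglyMeasurable fun t ht ↦
      (hφδ ((Metric.mem_ball.1 ht).trans hδ_lt.2.1)).le
  · rw [(hc.hasDerivAt_convolution_right _ ρ.continuous_normed.locallyIntegrable hφ x).deriv]
    exact ρ.dist_normed_convolution_le hφ'.aestronglyMeasurable fun t ht ↦
      (hφ'δ ((Metric.mem_ball.1 ht).trans hδ_lt.2.2)).le

end Mollification

section WeakDerivative

instance : IsProbabilityMeasure unitMeasure := ⟨by simp [unitMeasure]⟩

theorem L2.inner_eq_integral (f g : L2) : inner ℝ f g = ∫ x, f x * g x ∂unitMeasure := by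
  simp only [MeasureTheory.L2.inner_def, RCLike.inner_apply, conj_trivial, mul_comm]

/-- The pairs `(φ, φ')` for a test function `φ ∈ C_c^∞(0, 1)`. Weak derivatives are defined by
duality with these, whereas `H10` is the closure of the larger set `C1Compact`. -/
def CInfCompact : Set (L2 × L2) :=
  {q | ∃ φ : ℝ → ℝ, ContDiff ℝ ∞ φ ∧ HasCompactSupport φ ∧ tsupport φ ⊆ Ioo (0 : ℝ) 1 ∧
    q.1 =ᵐ[unitMeasure] φ ∧ q.2 =ᵐ[unitMeasure] deriv φ}

theorem L2.dist_le_of_ae_dist_le {f g : L2} {η : ℝ} (hη : 0 ≤ η)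
    (h : ∀ᵐ x ∂unitMeasure, dist (f x) (g x) ≤ η) : dist f g ≤ η := by
  rw [dist_eq_norm]
  refine (Lp.norm_le_of_ae_bound hη (f := f - g) ?_).trans (by simp [measureUnivNNReal])
  filter_upwards [Lp.coeFn_sub f g, h] with x hsub hx
  rwa [hsub, Pi.sub_apply, ← dist_eq_norm]

theorem C1Compact_subset_closure_CInfCompact : C1Compact ⊆ closure CInfCompact := by
  rintro ⟨u, v⟩ ⟨φ, hφ, hc, hφU, hu, hv⟩
  refine Metric.mem_closure_iff.2 fun δ hδ ↦ ?_
  obtain ⟨ψ, hψ, hψc, hψU, hψφ, hψφ'⟩ :=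
    exists_contDiff_dist_le_dist_deriv_le isOpen_Ioo hφ hc hφU (half_pos hδ)
  have memLp {χ : ℝ → ℝ} (hχ : Continuous χ) (hχc : HasCompactSupport χ) : MemLp χ 2 unitMeasure :=
    (hχ.memLp_of_hasCompactSupport hχc (μ := volume)).restrict _
  have hψL := memLp hψ.continuous hψc
  have hψL' := memLp (hψ.continuous_deriv (by simp)) hψc.deriv
  refine ⟨(hψL.toLp ψ, hψL'.toLp (deriv ψ)),
    ⟨ψ, hψ, hψc, hψU, hψL.coeFn_toLp, hψL'.coeFn_toLp⟩, ?_⟩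
  refine (max_le (L2.dist_le_of_ae_dist_le (half_pos hδ).le ?_)
    (L2.dist_le_of_ae_dist_le (half_pos hδ).le ?_)).trans_lt (half_lt_self hδ)
  · filter_upwards [hψL.coeFn_toLp, hu] with x hx hux
    rw [hx, hux, dist_comm]
    exact hψφ x
  · filter_upwards [hψL'.coeFn_toLp, hv] with x hx hvx
    rw [hx, hvx, dist_comm]
    exact hψφ' x

theorem IsWeakDeriv.inner_eq_neg_inner {f g : L2} (h : IsWeakDeriv f g) {q : L2 × L2}
    (hq : q ∈ H10) : inner ℝ f q.2 = - inner ℝ g q.1 := by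
  have hclosed : IsClosed {q : L2 × L2 | inner ℝ f q.2 = - inner ℝ g q.1} :=
    isClosed_eq (by fun_prop) (by fun_prop)
  have hq' : q ∈ closure CInfCompact :=
    closure_minimal C1Compact_subset_closure_CInfCompact isClosed_closure hq.2
  refine closure_minimal ?_ hclosed hq'
  rintro ⟨u, v⟩ ⟨φ, hφ, hc, hφU, hu, hv⟩
  simp only [mem_ofPred_eq, L2.inner_eq_integral]
  calc ∫ x, f x * v x ∂unitMeasure
      = ∫ x, f x * deriv φ x ∂unitMeasure := integral_congr_ae (hv.mono fun x hx ↦ congrArg _ hx)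
    _ = -∫ x, g x * φ x ∂unitMeasure := h φ hφ hc hφU
    _ = -∫ x, g x * u x ∂unitMeasure :=
        congrArg _ (integral_congr_ae (hu.mono fun x hx ↦ congrArg _ hx.symm))

end WeakDerivative

section Wirtinger

open Real

theorem hasDerivAt_mul_sq_of_riccati {φ k : ℝ → ℝ} {μ : ℝ} (hφ : Differentiable ℝ φ)
    (hk : ∀ x ∈ tsupport φ, HasDerivAt k (-(μ + k x ^ 2)) x) (x : ℝ) :
    HasDerivAt (fun x ↦ k x * φ x ^ 2)
      (deriv φ x ^ 2 - μ * φ x ^ 2 - (deriv φ x - k x * φ x) ^ 2) x := by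
  by_cases hx : x ∈ tsupport φ
  · convert! (hk x hx).mul ((hφ x).hasDerivAt.pow 2) using 1
    simp only [Pi.pow_apply]
    push_cast
    ring
  · have hφx := notMem_tsupport_iff_eventuallyEq.1 hx
    have hφ'x : deriv φ x = 0 := by simpa using hφx.deriv_eq
    rw [hφ'x, hφx.self_of_nhds]
    refine ((hasDerivAt_const x (0 : ℝ)).congr_of_eventuallyEq ?_).congr_deriv (by simp)
    filter_upwards [hφx] with t ht
    simp [ht]

theorem mul_integral_sq_le_integral_deriv_sq_of_riccati {φ k : ℝ → ℝ} {μ : ℝ}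
    (hφ : ContDiff ℝ 1 φ) (hc : HasCompactSupport φ)
    (hk : ∀ x ∈ tsupport φ, HasDerivAt k (-(μ + k x ^ 2)) x) :
    μ * ∫ x, φ x ^ 2 ≤ ∫ x, deriv φ x ^ 2 := by
  have hφ' : Continuous (deriv φ) := hφ.continuous_deriv le_rfl
  have hkφ : Continuous fun x ↦ k x * φ x := continuous_of_tsupport fun x hx ↦
    (hk x (tsupport_mul_subset_right hx)).continuousAt.mul hφ.continuous.continuousAt
  have hkφc : HasCompactSupport fun x ↦ k x * φ x := hc.mul_left
  have integrable_sq {g : ℝ → ℝ} (hg : Continuous g) (hgc : HasCompactSupport g) :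
      Integrable fun x ↦ g x ^ 2 := by
    simp only [sq]
    exact (hg.mul hg).integrable_of_hasCompactSupport hgc.mul_left
  have hφ2 := (integrable_sq hφ.continuous hc).const_mul μ
  have hφ'2 := integrable_sq hφ' hc.deriv
  have hdiff : Integrable fun x ↦ deriv φ x ^ 2 - μ * φ x ^ 2 := hφ'2.sub hφ2
  have hdefect : Integrable fun x ↦ (deriv φ x - k x * φ x) ^ 2 :=
    integrable_sq (hφ'.sub hkφ) (hc.deriv.sub hkφc)
  have hkφ2 : Integrable fun x ↦ k x * φ x ^ 2 := by
    refine Continuous.integrable_of_hasCompactSupport ?_ (hc.mono' ?_)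
    · exact (hkφ.mul hφ.continuous).congr fun x ↦ by simp only [Pi.mul_apply]; ring
    · exact fun x hx ↦ subset_tsupport φ fun h ↦ hx (by simp [h])
  have hzero := integral_eq_zero_of_hasDerivAt_of_integrable
    (hasDerivAt_mul_sq_of_riccati (hφ.differentiable one_ne_zero) hk) (hdiff.sub hdefect) hkφ2
  rw [integral_sub hdiff hdefect, integral_sub hφ'2 hφ2, integral_const_mul] at hzero
  have hdefect_nonneg : 0 ≤ ∫ x, (deriv φ x - k x * φ x) ^ 2 := integral_nonneg fun x ↦ sq_nonneg _
  linarith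

theorem hasDerivAt_mul_cot (r s x : ℝ) (hx : sin (r * (x - s)) ≠ 0) :
    HasDerivAt (fun x ↦ r * cot (r * (x - s))) (-(r ^ 2 + (r * cot (r * (x - s))) ^ 2)) x := by
  have hlin : HasDerivAt (fun x : ℝ ↦ r * (x - s)) r x := by
    simpa using ((hasDerivAt_id x).sub_const s).const_mul r
  simp only [cot_eq_cos_div_sin]
  convert! (hlin.cos.div hlin.sin hx).const_mul r using 1
  field_simp
  ring

theorem wirtinger_integral_sq_le {φ : ℝ → ℝ} {s t : ℝ} (hφ : ContDiff ℝ 1 φ)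
    (hc : HasCompactSupport φ) (hφU : tsupport φ ⊆ Ioo s t) :
    (π / (t - s)) ^ 2 * ∫ x, φ x ^ 2 ≤ ∫ x, deriv φ x ^ 2 := by
  -- `k` is the logarithmic derivative of the first Dirichlet eigenfunction.
  refine mul_integral_sq_le_integral_deriv_sq_of_riccati
    (k := fun x ↦ π / (t - s) * cot (π / (t - s) * (x - s))) hφ hc fun x hx ↦ ?_
  obtain ⟨hsx, hxt⟩ := hφU hx
  have hst : 0 < t - s := by linarith
  refine hasDerivAt_mul_cot _ _ _ (sin_pos_of_pos_of_lt_pi ?_ ?_).ne'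
  · have := sub_pos.2 hsx
    positivity
  · rw [div_mul_eq_mul_div, div_lt_iff₀ hst]
    gcongr

theorem L2.norm_sq_eq_integral {f : L2} {g : ℝ → ℝ} (hf : f =ᵐ[unitMeasure] g)
    (hg : tsupport g ⊆ Ioo 0 1) : ‖f‖ ^ 2 = ∫ x, g x ^ 2 := by
  have hout (x : ℝ) (hx : x ∉ Ioo (0 : ℝ) 1) : g x ^ 2 = 0 := by
    rw [image_eq_zero_of_notMem_tsupport fun h ↦ hx (hg h), zero_pow two_ne_zero]
  rw [← real_inner_self_eq_norm_sq, L2.inner_eq_integral,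
    ← setIntegral_eq_integral_of_forall_compl_eq_zero hout]
  exact integral_congr_ae (hf.mono fun x hx ↦ by simp only [hx, sq])

theorem sq_pi_mul_norm_sq_le {q : L2 × L2} (hq : q ∈ H10) : π ^ 2 * ‖q.1‖ ^ 2 ≤ ‖q.2‖ ^ 2 := by
  have hclosed : IsClosed {q : L2 × L2 | π ^ 2 * ‖q.1‖ ^ 2 ≤ ‖q.2‖ ^ 2} :=
    isClosed_le (by fun_prop) (by fun_prop)
  refine closure_minimal ?_ hclosed hq.2
  rintro ⟨u, v⟩ ⟨φ, hφ, hc, hφU, hu, hv⟩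
  rw [mem_ofPred_eq, L2.norm_sq_eq_integral hu hφU,
    L2.norm_sq_eq_integral hv ((closure_minimal support_deriv_subset isClosed_closure).trans hφU)]
  simpa using wirtinger_integral_sq_le hφ hc hφU

theorem H2H10.inner_dxx_le (v : H2H10) :
    inner ℝ (H2H10.toL2 v) (H2H10.dxx v) ≤ -(π ^ 2 * ‖H2H10.toL2 v‖ ^ 2) := by
  obtain ⟨⟨f, f', f''⟩, hf, hf'⟩ := v
  have hibp := IsWeakDeriv.inner_eq_neg_inner hf' hf
  rw [real_inner_self_eq_norm_sq] at hibp
  simp only [H2H10.toL2, H2H10.dxx]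
  rw [real_inner_comm]
  linarith [sq_pi_mul_norm_sq_le hf]

end Wirtinger

section Comparison

/-- Absolute continuity on every compact subinterval of `I`. -/
def LocallyACOn (f : ℝ → ℝ) (I : Set ℝ) : Prop :=
  ∀ ⦃s⦄, s ∈ I → ∀ ⦃t⦄, t ∈ I → s ≤ t → AbsolutelyContinuousOnInterval f s t

theorem LocallyACOn.mono {f : ℝ → ℝ} {I J : Set ℝ} (hf : LocallyACOn f J) (hIJ : I ⊆ J) :
    LocallyACOn f I :=
  fun _ hs _ ht hst ↦ hf (hIJ hs) (hIJ ht) hst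

theorem LocallyACOn.sq {f : ℝ → ℝ} {I : Set ℝ} (hf : LocallyACOn f I) :
    LocallyACOn (fun t ↦ f t ^ 2) I := fun s hs t ht hst ↦ by
  simp only [_root_.sq]
  exact (hf hs ht hst).mul (hf hs ht hst)

theorem LocallyACOn.add {f g : ℝ → ℝ} {I : Set ℝ} (hf : LocallyACOn f I) (hg : LocallyACOn g I) :
    LocallyACOn (fun t ↦ f t + g t) I :=
  fun _ hs _ ht hst ↦ (hf hs ht hst).add (hg hs ht hst)

theorem LocallyACOn.div_const {f : ℝ → ℝ} {I : Set ℝ} (hf : LocallyACOn f I) (c : ℝ) :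
    LocallyACOn (fun t ↦ f t / c) I := fun s hs t ht hst ↦ by
  simp only [div_eq_inv_mul]
  exact (hf hs ht hst).const_mul c⁻¹

theorem LocallyACOn.of_contDiffOn {f : ℝ → ℝ} {I : Set ℝ} [hI : OrdConnected I]
    (hf : ContDiffOn ℝ 1 f I) : LocallyACOn f I :=
  fun _ hs _ ht _ ↦ (hf.mono (hI.uIcc_subset hs ht)).absolutelyContinuousOnInterval

theorem le_of_deriv_nonpos_ae {f : ℝ → ℝ} {s t : ℝ} (hst : s ≤ t)
    (hf : AbsolutelyContinuousOnInterval f s t) (h : ∀ᵐ x, x ∈ Ioo s t → deriv f x ≤ 0) :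
    f t ≤ f s := by
  have hint := hf.integral_deriv_eq_sub
  rw [intervalIntegral.integral_of_le hst, integral_Ioc_eq_integral_Ioo] at hint
  have hle : ∫ x in Ioo s t, deriv f x ≤ 0 :=
    integral_nonpos_of_ae ((ae_restrict_iff' measurableSet_Ioo).2 h)
  linarith

theorem le_exp_mul_of_deriv_le_ae {f : ℝ → ℝ} {s t k R : ℝ} (hk : k ≠ 0) (hst : s ≤ t)
    (hf : AbsolutelyContinuousOnInterval f s t)
    (h : ∀ᵐ x, x ∈ Ioo s t → deriv f x ≤ -k * f x + R) :
    f t ≤ Real.exp (-k * (t - s)) * (f s - R / k) + R / k := by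
  have hexp : AbsolutelyContinuousOnInterval (fun x ↦ Real.exp (k * x)) s t :=
    ContDiffOn.absolutelyContinuousOnInterval (by fun_prop)
  have hconst : AbsolutelyContinuousOnInterval (fun _ ↦ R / k) s t :=
    ContDiffOn.absolutelyContinuousOnInterval contDiffOn_const
  have hdecr := le_of_deriv_nonpos_ae hst (hexp.mul (hf.sub hconst)) <| by
    filter_upwards [h, hf.ae_differentiableAt] with x hx hfx hxs
    have hfx := (hfx (by rw [uIcc_of_le hst]; exact Ioo_subset_Icc_self hxs)).hasDerivAt
    have hexp' : HasDerivAt (fun x ↦ Real.exp (k * x)) (Real.exp (k * x) * k) x := by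
      simpa using ((hasDerivAt_id x).const_mul k).exp
    rw [(hexp'.mul (hfx.sub (hasDerivAt_const x (R / k)))).deriv]
    calc Real.exp (k * x) * k * (f x - R / k) + Real.exp (k * x) * (deriv f x - 0)
        = Real.exp (k * x) * (k * f x - R + deriv f x) := by field_simp; ring
      _ ≤ 0 := mul_nonpos_of_nonneg_of_nonpos (Real.exp_pos _).le (by linarith [hx hxs])
  simp only [Pi.mul_apply, Pi.sub_apply] at hdecr
  have hexp_eq : Real.exp (-k * (t - s)) = Real.exp (k * s) / Real.exp (k * t) := by
    rw [← Real.exp_sub]; congr 1; ring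
  rw [← sub_le_iff_le_add, hexp_eq, div_mul_eq_mul_div, le_div_iff₀ (Real.exp_pos _)]
  linarith

theorem le_exp_mul_of_deriv_le_ae_Ioi {f : ℝ → ℝ} {k R : ℝ} (hk : k ≠ 0)
    (hc : ContinuousOn f (Ici 0)) (hf : LocallyACOn f (Ioi 0))
    (h : ∀ᵐ x, 0 < x → deriv f x ≤ -k * f x + R) {t : ℝ} (ht : 0 ≤ t) :
    f t ≤ Real.exp (-k * t) * (f 0 - R / k) + R / k := by
  rcases ht.eq_or_lt with rfl | ht
  · simp
  have hlim : Tendsto (fun s ↦ Real.exp (-k * (t - s)) * (f s - R / k) + R / k) (𝓝[>] 0)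
      (𝓝 (Real.exp (-k * (t - 0)) * (f 0 - R / k) + R / k)) := by
    have hf0 : Tendsto f (𝓝[>] 0) (𝓝 (f 0)) :=
      (hc 0 self_mem_Ici).mono_left (nhdsWithin_mono _ Ioi_subset_Ici_self)
    have hexp : Continuous fun s ↦ Real.exp (-k * (t - s)) := by fun_prop
    exact (((hexp.tendsto 0).mono_left nhdsWithin_le_nhds).mul (hf0.sub_const _)).add_const _
  rw [sub_zero] at hlim
  refine ge_of_tendsto hlim ?_
  filter_upwards [Ioo_mem_nhdsGT ht] with s hs
  exact le_exp_mul_of_deriv_le_ae hk hs.2.le (hf hs.1 ht hs.2.le)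
    (h.mono fun x hx hxs ↦ hx (hs.1.trans hxs.1))

theorem eventually_le_of_deriv_le_ae {f : ℝ → ℝ} {k R T M : ℝ} (hk : 0 < k)
    (hf : LocallyACOn f (Ici T)) (h : ∀ᵐ x, T < x → deriv f x ≤ -k * f x + R) (hM : R / k < M) :
    ∀ᶠ t in atTop, f t ≤ M := by
  have hdecay : Tendsto (fun t ↦ Real.exp (-k * (t - T))) atTop (𝓝 0) :=
    Real.tendsto_exp_atBot.comp
      ((tendsto_atTop_add_const_right _ (-T) tendsto_id).const_mul_atTop_of_neg (neg_lt_zero.2 hk))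
  have hlim := (hdecay.mul_const (f T - R / k)).add_const (R / k)
  rw [zero_mul, zero_add] at hlim
  filter_upwards [hlim.eventually (gt_mem_nhds hM), eventually_ge_atTop T] with t htM ht
  exact (le_exp_mul_of_deriv_le_ae hk.ne' ht (hf self_mem_Ici ht ht)
    (h.mono fun x hx hxs ↦ hx hxs.1)).trans htM.le

theorem limsup_le_div_of_deriv_sq_le {X m : ℝ → ℝ} {P T : ℝ} (hP : 0 < P) (hX : ∀ t, 0 ≤ X t)
    (hXac : LocallyACOn (fun t ↦ X t ^ 2) (Ioi T)) (hm : ∀ t, 0 ≤ m t)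
    (hmb : IsBoundedUnder (· ≤ ·) atTop m)
    (h : ∀ t > T, deriv (fun t ↦ X t ^ 2) t ≤ -2 * P * X t ^ 2 + 2 * m t * X t) :
    limsup X atTop ≤ limsup m atTop / P := by
  refine le_of_forall_gt_imp_ge_of_dense fun C hC ↦ ?_
  obtain ⟨μ, hμ, hμC⟩ := exists_between ((div_lt_iff₀ hP).1 hC)
  obtain ⟨S, hS⟩ := eventually_atTop.1 (eventually_lt_of_limsup_lt hμ hmb)
  have hμ0 : 0 ≤ μ := (hm S).trans (hS S le_rfl).le
  have hsq : ∀ᶠ t in atTop, X t ^ 2 ≤ C ^ 2 := by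
    refine eventually_le_of_deriv_le_ae (R := μ ^ 2 / P) (T := max S (T + 1)) hP
      (hXac.mono fun t ht ↦ ?_) (Eventually.of_forall fun t ht ↦ ?_) ?_
    · exact (lt_add_one T).trans_le ((le_max_right _ _).trans ht)
    · have hT : T < t := (lt_add_one T).trans ((le_max_right _ _).trans_lt ht)
      have hmX : m t * X t ≤ μ * X t :=
        mul_le_mul_of_nonneg_right (hS t ((le_max_left _ _).trans ht.le)).le (hX t)
      have hyoung : 2 * (μ * X t) ≤ P * X t ^ 2 + μ ^ 2 / P := by
        rw [← sub_nonneg]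
        have : P * X t ^ 2 + μ ^ 2 / P - 2 * (μ * X t) = (P * X t - μ) ^ 2 / P := by
          field_simp; ring
        rw [this]
        positivity
      linarith [h t hT]
    · rw [div_div, ← sq, ← div_pow]
      exact pow_lt_pow_left₀ ((div_lt_iff₀ hP).2 hμC) (by positivity) two_ne_zero
  have hC0 : 0 ≤ C := by
    by_contra! hC0
    nlinarith
  exact limsup_le_of_le (isCoboundedUnder_le_of_le atTop hX)
    (hsq.mono fun t ht ↦ (pow_le_pow_iff_left₀ (hX t) hC0 two_ne_zero).1 ht)

theorem monotoneOn_Ici_of_hasDerivAt_nonneg {F g : ℝ → ℝ} {a : ℝ} (hF : ContinuousOn F (Ici a))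
    (hF' : ∀ t > a, HasDerivAt F (g t) t) (hg : ∀ t > a, 0 ≤ g t) : MonotoneOn F (Ici a) :=
  monotoneOn_of_hasDerivWithinAt_nonneg (convex_Ici a) hF
    (fun t ht ↦ (hF' t (by simpa using ht)).hasDerivWithinAt) fun t ht ↦ hg t (by simpa using ht)

-- A one-sided Barbălat lemma: `g t` is at most the mean of `g` over `[t - h, t]` plus `Q h`.
theorem tendsto_zero_of_hasDerivAt_of_le {F g : ℝ → ℝ} {a B Q : ℝ}
    (hF : ∀ t > a, HasDerivAt F (g t) t) (hg : ∀ t > a, 0 ≤ g t) (hFB : ∀ t > a, F t ≤ B)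
    (hQ : 0 ≤ Q) (hgQ : ∀ s > a, ∀ t > s, g t ≤ g s + Q * (t - s)) : Tendsto g atTop (𝓝 0) := by
  have hmono : MonotoneOn F (Ici (a + 1)) := monotoneOn_Ici_of_hasDerivAt_nonneg
    (fun t ht ↦ (hF t ((lt_add_one a).trans_le ht)).continuousAt.continuousWithinAt)
    (fun t ht ↦ hF t ((lt_add_one a).trans ht)) fun t ht ↦ hg t ((lt_add_one a).trans ht)
  obtain ⟨l, hl⟩ : ∃ l, Tendsto F atTop (𝓝 l) := by
    have hmono' : Monotone fun t ↦ F (max t (a + 1)) := fun s t hst ↦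
      hmono (mem_Ici.2 (le_max_right _ _)) (mem_Ici.2 (le_max_right _ _)) (max_le_max_right _ hst)
    have hbdd : BddAbove (range fun t ↦ F (max t (a + 1))) :=
      ⟨B, forall_mem_range.2 fun t ↦ hFB _ ((lt_add_one a).trans_le (le_max_right _ _))⟩
    refine ⟨_, (tendsto_atTop_ciSup hmono' hbdd).congr' ?_⟩
    filter_upwards [eventually_ge_atTop (a + 1)] with t ht
    rw [max_eq_left ht]
  have hle {h t : ℝ} (hh : 0 < h) (ht : a < t - h) : g t ≤ (F t - F (t - h)) / h + Q * h := by
    obtain ⟨ξ, hξ, hFξ⟩ := exists_hasDerivAt_eq_slope F g (sub_lt_self t hh)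
      (fun x hx ↦ (hF x (ht.trans_le hx.1)).continuousAt.continuousWithinAt)
      fun x hx ↦ hF x (ht.trans hx.1)
    rw [sub_sub_cancel] at hFξ
    rw [← hFξ]
    refine (hgQ ξ (ht.trans hξ.1) t hξ.2).trans ?_
    gcongr
    linarith [hξ.1]
  refine tendsto_order.2 ⟨fun e he ↦ ?_, fun e he ↦ ?_⟩
  · filter_upwards [eventually_gt_atTop a] with t ht using he.trans_le (hg t ht)
  · obtain ⟨h, hh, hQh⟩ := exists_pos_mul_lt he Q
    have hlim : Tendsto (fun t ↦ (F t - F (t - h)) / h + Q * h) atTop (𝓝 (Q * h)) := by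
      have hshift := hl.comp (tendsto_atTop_add_const_right _ (-h) tendsto_id)
      simpa [← sub_eq_add_neg] using ((hl.sub hshift).div_const h).add_const (Q * h)
    filter_upwards [hlim.eventually (gt_mem_nhds hQh), eventually_gt_atTop (a + h)] with t hte ht
    exact (hle hh (by linarith)).trans_lt hte

end Comparison

section Gain

variable {V F : ℝ → ℝ} {ε Γ k Q : ℝ}

theorem absolutelyContinuousOnInterval_max_const {f : ℝ → ℝ} {s t : ℝ} (c : ℝ)
    (hf : AbsolutelyContinuousOnInterval f s t) :
    AbsolutelyContinuousOnInterval (fun x ↦ max (f x) c) s t := by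
  refine squeeze_zero (fun E ↦ Finset.sum_nonneg fun i _ ↦ dist_nonneg) (fun E ↦ ?_) hf
  exact Finset.sum_le_sum fun i _ ↦ abs_max_sub_max_le_abs _ _ _

theorem deriv_max_zero_le {g : ℝ → ℝ} {k x : ℝ} (hg : ContinuousAt g x)
    (h : 0 < g x → deriv g x ≤ -k * g x) :
    deriv (fun x ↦ max (g x) 0) x ≤ -k * max (g x) 0 := by
  rcases le_or_gt (g x) 0 with hgx | hgx
  · have hmin : IsLocalMin (fun x ↦ max (g x) 0) x :=
      Eventually.of_forall fun u ↦ by simp only [max_eq_right hgx, le_max_right]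
    rw [hmin.deriv_eq_zero, max_eq_right hgx, mul_zero]
  · have hev : (fun x ↦ max (g x) 0) =ᶠ[𝓝 x] g :=
      (hg.eventually (lt_mem_nhds hgx)).mono fun u hu ↦ max_eq_left hu.le
    rw [hev.deriv_eq, max_eq_left hgx.le]
    exact h hgx

theorem gain_add_excess_le {s t : ℝ} (hΓ : 0 ≤ Γ) (hk : 0 < k) (hst : s ≤ t)
    (hV : AbsolutelyContinuousOnInterval V s t) (hF : AbsolutelyContinuousOnInterval F s t)
    (hF' : ∀ x ∈ Ioo s t, HasDerivAt F (Γ * max (V x - ε) 0) x)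
    (hV' : ∀ᵐ x, x ∈ Ioo s t → deriv V x ≤ -k * V x + k * ε) :
    F t + Γ / k * max (V t - ε) 0 ≤ F s + Γ / k * max (V s - ε) 0 := by
  have hconst : AbsolutelyContinuousOnInterval (fun _ ↦ ε) s t :=
    ContDiffOn.absolutelyContinuousOnInterval contDiffOn_const
  have hexc := absolutelyContinuousOnInterval_max_const 0 (hV.sub hconst)
  refine le_of_deriv_nonpos_ae hst (hF.add (hexc.const_mul (Γ / k))) ?_
  filter_upwards [hV', hV.ae_differentiableAt, hexc.ae_differentiableAt] with x hx hVx hexcx hxs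
  have hxst : x ∈ uIcc s t := by rw [uIcc_of_le hst]; exact Ioo_subset_Icc_self hxs
  have hle : deriv (fun x ↦ max (V x - ε) 0) x ≤ -k * max (V x - ε) 0 := by
    refine deriv_max_zero_le ((hVx hxst).continuousAt.sub continuousAt_const) fun _ ↦ ?_
    rw [deriv_sub_const]
    linarith [hx hxs]
  rw [((hF' x hxs).add ((hexcx hxst).hasDerivAt.const_mul (Γ / k))).deriv]
  calc Γ * max (V x - ε) 0 + Γ / k * deriv (fun x ↦ max (V x - ε) 0) x
      ≤ Γ * max (V x - ε) 0 + Γ / k * (-k * max (V x - ε) 0) := by gcongr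
    _ = 0 := by field_simp; ring

theorem gain_le {B : ℝ} (hε : 0 < ε) (hΓ : 0 ≤ Γ) (hk : 0 < k)
    (hQ : 0 ≤ Q) (hB : 0 ≤ B) (hVB : ∀ t ≥ 0, V t ≤ B) (hV : LocallyACOn V (Ici 0))
    (hF : LocallyACOn F (Ici 0)) (hFpos : ∀ t ≥ 0, 0 < F t) (hFmono : MonotoneOn F (Ici 0))
    (hF' : ∀ t > 0, HasDerivAt F (Γ * max (V t - ε) 0) t)
    (hV' : ∀ᵐ t, 0 < t → deriv V t ≤ -k * V t + Q / F t) {t : ℝ} (ht : 0 ≤ t) :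
    F t ≤ F 0 + Q / (k * ε) + Γ / k * B := by
  have hB' : 0 ≤ Γ / k * B := by positivity
  rcases le_total (F t) (Q / (k * ε)) with hle | hge
  · linarith [hFpos 0 le_rfl]
  obtain ⟨s, ⟨hs0, hst⟩, hsQ, hFs⟩ :
      ∃ s ∈ Icc 0 t, Q / (k * ε) ≤ F s ∧ F s ≤ F 0 + Q / (k * ε) := by
    rcases le_total (Q / (k * ε)) (F 0) with h0 | h0
    · exact ⟨0, left_mem_Icc.2 ht, h0, le_add_of_nonneg_right (by positivity)⟩
    · have hFc := (hF self_mem_Ici ht ht).continuousOn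
      rw [uIcc_of_le ht] at hFc
      obtain ⟨s, hs, hsF⟩ := intermediate_value_Icc ht hFc ⟨h0, hge⟩
      exact ⟨s, hs, hsF.ge, by linarith [hFpos 0 le_rfl]⟩
  have hdecr := gain_add_excess_le hΓ hk hst (hV hs0 ht hst) (hF hs0 ht hst)
    (fun x hx ↦ hF' x (hs0.trans_lt hx.1)) <| by
      filter_upwards [hV'] with x hx hxs
      have hsx : s ≤ x := hxs.1.le
      have hFx : Q / F x ≤ k * ε := by
        rw [div_le_iff₀ (hFpos x (hs0.trans hsx)), mul_comm, ← div_le_iff₀ (by positivity)]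
        exact hsQ.trans (hFmono hs0 (hs0.trans hsx) hsx)
      linarith [hx (hs0.trans_lt hxs.1)]
  have hexc_s : Γ / k * max (V s - ε) 0 ≤ Γ / k * B := by
    gcongr
    exact max_le (by linarith [hVB s hs0]) hB
  have hexc_t : 0 ≤ Γ / k * max (V t - ε) 0 := by positivity
  linarith

end Gain

section Rates

theorem mul_le_mul_sq_add_sq_div {β x y : ℝ} (hβ : 0 < β) :
    x * y ≤ β * x ^ 2 + y ^ 2 / (4 * β) := by
  have : β * x ^ 2 + y ^ 2 / (4 * β) - x * y = (2 * β * x - y) ^ 2 / (4 * β) := by field_simp; ring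
  rw [← sub_nonneg, this]
  positivity

theorem mul_feedback_le {a b c : ℝ} (ha : 0 < a) (hab : a ≤ b) (hb : 1 ≤ b) (hc : 1 ≤ c)
    (y z : ℝ) :
    y * feedback a b c y z ≤ -c * y ^ 2 - y ^ 4 - (b + Real.exp z) / a / 4 * y ^ 2
      - ((b + Real.exp z) / a) ^ 3 / 4 * y ^ 4 := by
  have hz := Real.exp_pos z
  have hgain : (b + Real.exp z) ^ 7 / (4 * a ^ 6)
      = (b + Real.exp z) * ((b + Real.exp z) / a) ^ 6 / 4 := by field_simp
  rw [feedback, hgain]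
  have hq : 1 ≤ b + Real.exp z := by linarith
  have hr : 1 ≤ (b + Real.exp z) / a := by rw [le_div_iff₀ ha]; linarith
  generalize b + Real.exp z = q at *
  generalize q / a = r at *
  have hr3 : r ^ 3 ≤ q * r ^ 6 :=
    (pow_le_pow_right₀ hr (by norm_num)).trans (le_mul_of_one_le_left (by positivity) hq)
  have hr1 : r ≤ q * r ^ 6 := (le_self_pow₀ hr (by norm_num)).trans hr3
  have hy2 : r / 4 * y ^ 2 ≤ q * r ^ 6 / 4 * y ^ 2 := by gcongr
  have hy4 : r ^ 3 / 4 * y ^ 4 ≤ q * r ^ 6 / 4 * y ^ 4 := by gcongr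
  have hy8 : 0 ≤ c * ((1 + q * r ^ 6 / 4) * y ^ 8) := by positivity
  have hcy : y ^ 4 + q * r ^ 6 / 4 * (y ^ 4 + y ^ 2)
      ≤ c * (y ^ 4 + q * r ^ 6 / 4 * (y ^ 4 + y ^ 2)) := le_mul_of_one_le_left (by positivity) hc
  linarith

variable {P c r X Y D Θ : ℝ}

theorem energy_rate_le {k ρ s₁ s₂ : ℝ} (hP : 0 < P) (hρ : 0 < ρ) (hρr : ρ ≤ r) (hkP : k ≤ P / 2)
    (hkc : k ≤ 2 * c) (hs : s₁ ^ 2 + s₂ ^ 2 ≤ Θ ^ 2) :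
    -2 * P * X ^ 2 + 2 * s₁ * Y * X
        + 2 * (-c * Y ^ 2 - Y ^ 4 - r / 4 * Y ^ 2 - r ^ 3 / 4 * Y ^ 4 + s₂ * X * Y + D * Y)
      ≤ -k * (X ^ 2 + Y ^ 2) + (2 / ρ * D ^ 2 + Θ ^ 4 / (2 * P ^ 2)) := by
  have hXY : X * (2 * (s₁ + s₂) * Y) ≤ 3 / 2 * P * X ^ 2 + Θ ^ 2 / P * (4 / 3 * Y ^ 2) := by
    refine (mul_le_mul_sq_add_sq_div (β := 3 / 2 * P) (by positivity)).trans ?_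
    have hs' : (s₁ + s₂) ^ 2 ≤ 2 * Θ ^ 2 := add_sq_le.trans (by linarith)
    calc 3 / 2 * P * X ^ 2 + (2 * (s₁ + s₂) * Y) ^ 2 / (4 * (3 / 2 * P))
        = 3 / 2 * P * X ^ 2 + (s₁ + s₂) ^ 2 / P * (2 / 3 * Y ^ 2) := by field_simp; ring
      _ ≤ 3 / 2 * P * X ^ 2 + 2 * Θ ^ 2 / P * (2 / 3 * Y ^ 2) := by gcongr
      _ = 3 / 2 * P * X ^ 2 + Θ ^ 2 / P * (4 / 3 * Y ^ 2) := by ring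
  have hΘY : Θ ^ 2 / P * (4 / 3 * Y ^ 2) ≤ Θ ^ 4 / (2 * P ^ 2) + 8 / 9 * Y ^ 4 :=
    (mul_le_mul_sq_add_sq_div one_half_pos).trans_eq (by field_simp; ring)
  have hDY : D * (2 * Y) ≤ 2 / ρ * D ^ 2 + ρ / 2 * Y ^ 2 :=
    (mul_le_mul_sq_add_sq_div (β := 2 / ρ) (by positivity)).trans_eq (by field_simp; ring)
  have hρY : ρ / 2 * Y ^ 2 ≤ r / 2 * Y ^ 2 := by gcongr
  have hrY : 0 ≤ r ^ 3 / 4 * Y ^ 4 := by have := hρ.trans_le hρr; positivity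
  have hkX : k * X ^ 2 ≤ P / 2 * X ^ 2 := by gcongr
  have hkY : k * Y ^ 2 ≤ 2 * c * Y ^ 2 := by gcongr
  have hY : 0 ≤ Y ^ 4 := by positivity
  linarith

theorem output_rate_le {s : ℝ} (hP : 0 < P) (hr : 0 < r) (hs : s ^ 2 ≤ Θ ^ 2) :
    -c * Y ^ 2 - Y ^ 4 - r / 4 * Y ^ 2 - r ^ 3 / 4 * Y ^ 4 + s * X * Y + D * Y
      ≤ -c * Y ^ 2 + (D ^ 2 + P / 2 * X ^ 2 + Θ ^ 4 / (4 * P ^ 2)) / r := by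
  have hXY : X * (s * Y) ≤ P / (2 * r) * X ^ 2 + Θ ^ 2 / P * (r / 2 * Y ^ 2) := by
    refine (mul_le_mul_sq_add_sq_div (β := P / (2 * r)) (by positivity)).trans ?_
    calc P / (2 * r) * X ^ 2 + (s * Y) ^ 2 / (4 * (P / (2 * r)))
        = P / (2 * r) * X ^ 2 + s ^ 2 / P * (r / 2 * Y ^ 2) := by field_simp; ring
      _ ≤ P / (2 * r) * X ^ 2 + Θ ^ 2 / P * (r / 2 * Y ^ 2) := by gcongr
  have hΘY : Θ ^ 2 / P * (r / 2 * Y ^ 2) ≤ Θ ^ 4 / (4 * P ^ 2) / r + r ^ 3 / 4 * Y ^ 4 :=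
    (mul_le_mul_sq_add_sq_div (β := 1 / (4 * r)) (by positivity)).trans_eq (by field_simp; ring)
  have hDY : D * Y ≤ D ^ 2 / r + r / 4 * Y ^ 2 :=
    (mul_le_mul_sq_add_sq_div (β := 1 / r) (by positivity)).trans_eq (by field_simp)
  have hY : 0 ≤ Y ^ 4 := by positivity
  calc _ ≤ -c * Y ^ 2 + (D ^ 2 / r + P / (2 * r) * X ^ 2 + Θ ^ 4 / (4 * P ^ 2) / r) := by linarith
    _ = _ := by field_simp

end Rates

section Constants

variable {ε Γ a b c p D Θ E₀ : ℝ}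

theorem kappa_pos (hp : 0 < p) (hc : 0 < c) : 0 < kappa p c :=
  lt_min (by positivity) (by positivity)

theorem Kbar_eq (hb : 0 < b) (hp : 0 < p) (hc : 0 < c) :
    Kbar a b c p = 1 + p * Real.pi ^ 2 / 2 + a * (p * Real.pi ^ 2) / (b * kappa p c)
      + 1 / (4 * (p * Real.pi ^ 2) * kappa p c) := by
  have hκ := kappa_pos hp hc
  unfold Kbar
  field_simp
  ring

theorem Kbar_pos (ha : 0 < a) (hb : 0 < b) (hp : 0 < p) (hc : 0 < c) : 0 < Kbar a b c p := by
  have hκ := kappa_pos hp hc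
  rw [Kbar_eq hb hp hc]
  positivity

theorem Bbar_mul (hε : ε ≠ 0) (hc : c ≠ 0) (S : ℝ) :
    Bbar ε Γ a b c p * S = a * Kbar a b c p * S / (2 * c * ε)
      + Γ / (2 * c) * (S / 2 + a * Kbar a b c p * S / (2 * c)) := by
  unfold Bbar
  field_simp
  ring

/-- The ultimate bound `R / κ` on the energy, `R` being the constant of the energy inequality. -/
noncomputable def residualEnergy (a b c p D Θ : ℝ) : ℝ :=
  (2 * (a / b) * D ^ 2 + Θ ^ 4 / (2 * (p * Real.pi ^ 2) ^ 2)) / kappa p c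

theorem residualEnergy_nonneg (ha : 0 ≤ a) (hb : 0 ≤ b) (hp : 0 < p) (hc : 0 < c) :
    0 ≤ residualEnergy a b c p D Θ := by
  have hκ := kappa_pos hp hc
  unfold residualEnergy
  positivity

theorem residualEnergy_le (ha : 0 ≤ a) (hb : 0 ≤ b) (hp : 0 < p) (hc : 0 < c) :
    residualEnergy a b c p D Θ ≤ 2 * a * ((D ^ 2 + Θ ^ 8 + 2 * (p ^ 2)⁻¹) / (b * kappa p c))
      + Θ ^ 4 / (2 * p ^ 2 * Real.pi ^ 4 * kappa p c) := by
  have hκ := kappa_pos hp hc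
  calc residualEnergy a b c p D Θ
      = 2 * a * (D ^ 2 / (b * kappa p c)) + Θ ^ 4 / (2 * p ^ 2 * Real.pi ^ 4 * kappa p c) := by
        unfold residualEnergy; field
    _ ≤ _ := by
      gcongr
      have : 0 ≤ Θ ^ 8 + 2 * (p ^ 2)⁻¹ := by positivity
      linarith

/-- The size of the data that governs the growth of the gain: `D` and `Θ` bound the disturbance
and the coefficients, `E₀` is the initial energy. -/
noncomputable def dataSize (p D Θ E₀ : ℝ) : ℝ :=
  D ^ 2 + Θ ^ 4 + Θ ^ 8 + 2 * (p ^ 2)⁻¹ + E₀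

theorem le_dataSize : E₀ ≤ dataSize p D Θ E₀ :=
  le_add_of_nonneg_left (by positivity)

theorem pow_four_div_sq_le (hp : 0 < p) (hc : 0 < c) :
    Θ ^ 4 / (4 * (p * Real.pi ^ 2) ^ 2)
      ≤ 1 / (4 * (p * Real.pi ^ 2) * kappa p c) * Θ ^ 8 + 2 * (p ^ 2)⁻¹ := by
  have hκ := kappa_pos hp hc
  have hκP : kappa p c ≤ p * Real.pi ^ 2 / 2 := min_le_left _ _
  have hpP : p ≤ p * Real.pi ^ 2 :=
    le_mul_of_one_le_right hp.le (one_le_pow₀ (by linarith [Real.pi_gt_three]))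
  generalize p * Real.pi ^ 2 = P at *
  have hP : 0 < P := hp.trans_le hpP
  calc Θ ^ 4 / (4 * P ^ 2) ≤ (Θ ^ 8 + 1) / 2 / (4 * P ^ 2) := by
        gcongr
        nlinarith [sq_nonneg (Θ ^ 4 - 1)]
    _ = 1 / (4 * P * (2 * P)) * Θ ^ 8 + 1 / 8 * (P ^ 2)⁻¹ := by field
    _ ≤ 1 / (4 * P * kappa p c) * Θ ^ 8 + 2 * (p ^ 2)⁻¹ := by
        gcongr
        · linarith
        · norm_num

theorem disturbance_le_Kbar_mul {X : ℝ} (ha : 0 < a) (hb : 0 < b) (hp : 0 < p) (hc : 0 < c)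
    (hE₀ : 0 ≤ E₀) (hX : X ^ 2 ≤ E₀ + residualEnergy a b c p D Θ) :
    D ^ 2 + p * Real.pi ^ 2 / 2 * X ^ 2 + Θ ^ 4 / (4 * (p * Real.pi ^ 2) ^ 2)
      ≤ Kbar a b c p * dataSize p D Θ E₀ := by
  have hκ := kappa_pos hp hc
  have hP : 0 < p * Real.pi ^ 2 := by positivity
  have hΘ := pow_four_div_sq_le (Θ := Θ) hp hc
  rw [residualEnergy] at hX
  rw [Kbar_eq hb hp hc]
  generalize p * Real.pi ^ 2 = P at *
  generalize kappa p c = κ at *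
  have hPX : P / 2 * X ^ 2
      ≤ P / 2 * E₀ + a * P / (b * κ) * D ^ 2 + 1 / (4 * P * κ) * Θ ^ 4 := by
    calc P / 2 * X ^ 2 ≤ P / 2 * (E₀ + (2 * (a / b) * D ^ 2 + Θ ^ 4 / (2 * P ^ 2)) / κ) := by gcongr
      _ = _ := by field
  have hS : dataSize p D Θ E₀ = D ^ 2 + Θ ^ 4 + Θ ^ 8 + 2 * (p ^ 2)⁻¹ + E₀ := rfl
  have hΘ4 : 0 ≤ Θ ^ 4 := by positivity
  have hΘ8 : 0 ≤ Θ ^ 8 := by positivity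
  have hp2 : 0 ≤ 2 * (p ^ 2)⁻¹ := by positivity
  have hD : 0 ≤ D ^ 2 := sq_nonneg D
  calc D ^ 2 + P / 2 * X ^ 2 + Θ ^ 4 / (4 * P ^ 2)
      ≤ (D ^ 2 + 2 * (p ^ 2)⁻¹) + P / 2 * E₀ + a * P / (b * κ) * D ^ 2
          + 1 / (4 * P * κ) * (Θ ^ 4 + Θ ^ 8) := by linarith
    _ ≤ dataSize p D Θ E₀ + P / 2 * dataSize p D Θ E₀ + a * P / (b * κ) * dataSize p D Θ E₀
          + 1 / (4 * P * κ) * dataSize p D Θ E₀ := by gcongr <;> linarith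
    _ = _ := by ring

end Constants

/-- The scalar inequalities to which the closed-loop system reduces: `X` stands for `‖w‖`, the
coefficients `s₁, s₂` for `|θ₁|, |θ₂|`, and `D, Θ` for the essential bounds of `d` and `θ`. -/
structure IsDADSLoop (ε Γ a b c p D Θ : ℝ) (s₁ s₂ X y z : ℝ → ℝ) : Prop where
  X_nonneg : ∀ t, 0 ≤ X t
  X_continuous : ContinuousOn X (Ici 0)
  X_sq_contDiff : ContDiffOn ℝ 1 (fun t ↦ X t ^ 2) (Ioi 0)
  deriv_X_sq_le : ∀ t > 0, deriv (fun t ↦ X t ^ 2) t ≤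
    -2 * (p * Real.pi ^ 2) * X t ^ 2 + 2 * s₁ t * |y t| * X t
  y_continuous : ContinuousOn y (Ici 0)
  y_locallyAC : LocallyACOn y (Ici 0)
  y_differentiable : ∀ᵐ t, 0 < t → DifferentiableAt ℝ y t
  mul_deriv_y_le : ∀ᵐ t, 0 < t →
    y t * deriv y t ≤ y t * feedback a b c (y t) (z t) + s₂ t * X t * |y t| + D * |y t|
  z_contDiff : ContDiffOn ℝ 1 z (Ici 0)
  z_eqn : ∀ t > 0, HasDerivAt z (update ε Γ (y t) (z t)) t
  s₁_nonneg : ∀ t, 0 ≤ s₁ t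
  coeff_sq_le : ∀ᵐ t, 0 < t → s₁ t ^ 2 + s₂ t ^ 2 ≤ Θ ^ 2

namespace IsDADSLoop

variable {ε Γ a b c p D Θ : ℝ} {s₁ s₂ X y z : ℝ → ℝ}

theorem deriv_y_sq_le (h : IsDADSLoop ε Γ a b c p D Θ s₁ s₂ X y z) (ha : 0 < a) (hab : a ≤ b)
    (hb : 1 ≤ b) (hc : 1 ≤ c) :
    ∀ᵐ t, 0 < t → deriv (fun t ↦ y t ^ 2) t ≤
      2 * (-c * |y t| ^ 2 - |y t| ^ 4 - (b + Real.exp (z t)) / a / 4 * |y t| ^ 2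
        - ((b + Real.exp (z t)) / a) ^ 3 / 4 * |y t| ^ 4 + s₂ t * X t * |y t| + D * |y t|) := by
  filter_upwards [h.y_differentiable, h.mul_deriv_y_le] with t hy hle ht
  have hfeedback := mul_feedback_le ha hab hb hc (y t) (z t)
  have hderiv : deriv (fun t ↦ y t ^ 2) t = 2 * (y t * deriv y t) := by
    rw [deriv_fun_pow (hy ht)]
    push_cast
    ring
  rw [hderiv, sq_abs, Even.pow_abs (by decide)]
  linarith [hle ht]

theorem deriv_energy_le (h : IsDADSLoop ε Γ a b c p D Θ s₁ s₂ X y z) (ha : 0 < a) (hab : a ≤ b)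
    (hb : 1 ≤ b) (hc : 1 ≤ c) (hp : 0 < p) :
    ∀ᵐ t, 0 < t → deriv (fun t ↦ X t ^ 2 + y t ^ 2) t ≤ -kappa p c * (X t ^ 2 + y t ^ 2)
      + (2 * (a / b) * D ^ 2 + Θ ^ 4 / (2 * (p * Real.pi ^ 2) ^ 2)) := by
  filter_upwards [h.y_differentiable, h.deriv_y_sq_le ha hab hb hc, h.coeff_sq_le]
    with t hy hysq hs ht
  have hX : DifferentiableAt ℝ (fun t ↦ X t ^ 2) t :=
    (h.X_sq_contDiff.differentiableOn one_ne_zero).differentiableAt (Ioi_mem_nhds ht)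
  have hr : b / a ≤ (b + Real.exp (z t)) / a := by
    gcongr
    exact le_add_of_nonneg_right (Real.exp_pos _).le
  have hrate := energy_rate_le (c := c) (X := X t) (Y := |y t|) (D := D) (k := kappa p c)
    (by positivity : 0 < p * Real.pi ^ 2) (by positivity) hr (min_le_left _ _) (min_le_right _ _)
    (hs ht)
  rw [deriv_fun_add hX ((hy ht).fun_pow 2)]
  calc deriv (fun t ↦ X t ^ 2) t + deriv (fun t ↦ y t ^ 2) t ≤ _ :=
        add_le_add (h.deriv_X_sq_le t ht) (hysq ht)
    _ ≤ _ := hrate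
    _ = _ := by rw [sq_abs]; field

theorem energy_le (h : IsDADSLoop ε Γ a b c p D Θ s₁ s₂ X y z) (ha : 0 < a) (hab : a ≤ b)
    (hb : 1 ≤ b) (hc : 1 ≤ c) (hp : 0 < p) {t : ℝ} (ht : 0 ≤ t) :
    X t ^ 2 + y t ^ 2
      ≤ Real.exp (-kappa p c * t) * (X 0 ^ 2 + y 0 ^ 2) + residualEnergy a b c p D Θ := by
  have hac : LocallyACOn (fun t ↦ X t ^ 2 + y t ^ 2) (Ioi 0) :=
    (LocallyACOn.of_contDiffOn h.X_sq_contDiff).add (h.y_locallyAC.mono Ioi_subset_Ici_self).sq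
  have hle := le_exp_mul_of_deriv_le_ae_Ioi (kappa_pos hp (by positivity)).ne'
    ((h.X_continuous.pow 2).add (h.y_continuous.pow 2)) hac (h.deriv_energy_le ha hab hb hc hp) ht
  refine hle.trans ?_
  rw [← residualEnergy]
  gcongr
  exact sub_le_self _ (residualEnergy_nonneg ha.le (by positivity) hp (by positivity))

theorem deriv_output_le (h : IsDADSLoop ε Γ a b c p D Θ s₁ s₂ X y z) (ha : 0 < a) (hab : a ≤ b)
    (hb : 1 ≤ b) (hc : 1 ≤ c) (hp : 0 < p) :
    ∀ᵐ t, 0 < t → deriv (fun t ↦ y t ^ 2 / 2) t ≤ -(2 * c) * (y t ^ 2 / 2)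
      + a * Kbar a b c p * dataSize p D Θ (X 0 ^ 2 + y 0 ^ 2) / (b + Real.exp (z t)) := by
  have hb0 : 0 < b := by positivity
  have hc0 : 0 < c := by positivity
  filter_upwards [h.deriv_y_sq_le ha hab hb hc, h.coeff_sq_le] with t hysq hs ht
  have hr : 0 < (b + Real.exp (z t)) / a := by positivity
  have hκt : Real.exp (-kappa p c * t) ≤ 1 :=
    Real.exp_le_one_iff.2 (by nlinarith [kappa_pos hp hc0])
  have hX : X t ^ 2 ≤ (X 0 ^ 2 + y 0 ^ 2) + residualEnergy a b c p D Θ := by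
    have hE₀ := mul_le_of_le_one_left (by positivity : 0 ≤ X 0 ^ 2 + y 0 ^ 2) hκt
    linarith [h.energy_le ha hab hb hc hp ht.le, sq_nonneg (y t)]
  have hs₂ : s₂ t ^ 2 ≤ Θ ^ 2 := by linarith [hs ht, sq_nonneg (s₁ t)]
  have hdist := disturbance_le_Kbar_mul ha hb0 hp hc0 (by positivity) hX
  rw [deriv_div_const]
  calc deriv (fun t ↦ y t ^ 2) t / 2
      ≤ -c * |y t| ^ 2 + (D ^ 2 + p * Real.pi ^ 2 / 2 * X t ^ 2
          + Θ ^ 4 / (4 * (p * Real.pi ^ 2) ^ 2)) / ((b + Real.exp (z t)) / a) := by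
        linarith [hysq ht, output_rate_le (c := c) (X := X t) (Y := |y t|) (D := D)
          (by positivity : 0 < p * Real.pi ^ 2) hr hs₂]
    _ ≤ -c * |y t| ^ 2 + Kbar a b c p * dataSize p D Θ (X 0 ^ 2 + y 0 ^ 2)
          / ((b + Real.exp (z t)) / a) := by gcongr
    _ = _ := by rw [sq_abs]; field

theorem output_le (h : IsDADSLoop ε Γ a b c p D Θ s₁ s₂ X y z) (ha : 0 < a) (hab : a ≤ b)
    (hb : 1 ≤ b) (hc : 1 ≤ c) (hp : 0 < p) {t : ℝ} (ht : 0 ≤ t) :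
    y t ^ 2 / 2 ≤ dataSize p D Θ (X 0 ^ 2 + y 0 ^ 2) / 2
      + a * Kbar a b c p * dataSize p D Θ (X 0 ^ 2 + y 0 ^ 2) / (2 * c) := by
  have hK : 0 < Kbar a b c p := Kbar_pos ha (by positivity) hp (by positivity)
  have hE₀ : X 0 ^ 2 + y 0 ^ 2 ≤ dataSize p D Θ (X 0 ^ 2 + y 0 ^ 2) := le_dataSize
  have hS : 0 ≤ dataSize p D Θ (X 0 ^ 2 + y 0 ^ 2) := le_trans (by positivity) hE₀
  have hderiv := h.deriv_output_le ha hab hb hc hp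
  generalize dataSize p D Θ (X 0 ^ 2 + y 0 ^ 2) = S at *
  have hle := le_exp_mul_of_deriv_le_ae_Ioi (f := fun t ↦ y t ^ 2 / 2) (k := 2 * c)
    (R := a * Kbar a b c p * S) (by positivity) ((h.y_continuous.pow 2).div_const 2)
    ((h.y_locallyAC.mono Ioi_subset_Ici_self).sq.div_const 2) (by
      filter_upwards [hderiv] with t ht' ht
      refine (ht' ht).trans ?_
      gcongr
      exact div_le_self (by positivity) (by linarith [Real.exp_pos (z t)])) ht
  refine hle.trans (add_le_add_left ?_ _)
  have hexp : Real.exp (-(2 * c) * t) ≤ 1 := Real.exp_le_one_iff.2 (by nlinarith)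
  calc Real.exp (-(2 * c) * t) * (y 0 ^ 2 / 2 - a * Kbar a b c p * S / (2 * c))
      ≤ Real.exp (-(2 * c) * t) * (y 0 ^ 2 / 2) := by
        gcongr
        exact sub_le_self _ (by positivity)
    _ ≤ y 0 ^ 2 / 2 := mul_le_of_le_one_left (by positivity) hexp
    _ ≤ S / 2 := by linarith [sq_nonneg (X 0)]

theorem hasDerivAt_exp_z (h : IsDADSLoop ε Γ a b c p D Θ s₁ s₂ X y z) {t : ℝ} (ht : 0 < t) :
    HasDerivAt (fun t ↦ Real.exp (z t)) (Γ * max (y t ^ 2 / 2 - ε) 0) t := by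
  refine (h.z_eqn t ht).exp.congr_deriv ?_
  rw [update, Real.exp_neg]
  field_simp

theorem monotoneOn_z (h : IsDADSLoop ε Γ a b c p D Θ s₁ s₂ X y z) (hΓ : 0 ≤ Γ) :
    MonotoneOn z (Ici 0) :=
  monotoneOn_Ici_of_hasDerivAt_nonneg h.z_contDiff.continuousOn h.z_eqn fun t _ ↦ by
    unfold update
    positivity

theorem exp_z_le (h : IsDADSLoop ε Γ a b c p D Θ s₁ s₂ X y z) (hε : 0 < ε) (hΓ : 0 ≤ Γ)
    (ha : 0 < a) (hab : a ≤ b) (hb : 1 ≤ b) (hc : 1 ≤ c) (hp : 0 < p) {t : ℝ} (ht : 0 ≤ t) :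
    Real.exp (z t) ≤ Real.exp (z 0)
      + Bbar ε Γ a b c p * dataSize p D Θ (X 0 ^ 2 + y 0 ^ 2) := by
  have hK : 0 < Kbar a b c p := Kbar_pos ha (by positivity) hp (by positivity)
  have hS : 0 ≤ dataSize p D Θ (X 0 ^ 2 + y 0 ^ 2) := le_trans (by positivity) le_dataSize
  have hderiv := h.deriv_output_le ha hab hb hc hp
  have hVB (t : ℝ) (ht : t ≥ 0) := h.output_le ha hab hb hc hp ht
  rw [Bbar_mul hε.ne' (by positivity), ← add_assoc]
  generalize dataSize p D Θ (X 0 ^ 2 + y 0 ^ 2) = S at *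
  refine gain_le (V := fun t ↦ y t ^ 2 / 2) (F := fun t ↦ Real.exp (z t)) hε hΓ (by positivity)
    (by positivity) (by positivity) hVB (h.y_locallyAC.sq.div_const 2)
    (LocallyACOn.of_contDiffOn h.z_contDiff.exp) (fun t _ ↦ Real.exp_pos _)
    (Real.exp_monotone.comp_monotoneOn (h.monotoneOn_z hΓ)) (fun t ht ↦ h.hasDerivAt_exp_z ht) ?_ ht
  filter_upwards [hderiv] with t ht' ht
  refine (ht' ht).trans ?_
  gcongr
  exact le_add_of_nonneg_left (by positivity)

theorem output_le_add (h : IsDADSLoop ε Γ a b c p D Θ s₁ s₂ X y z) (ha : 0 < a) (hab : a ≤ b)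
    (hb : 1 ≤ b) (hc : 1 ≤ c) (hp : 0 < p) {s t : ℝ} (hs : 0 < s) (hst : s ≤ t) :
    y t ^ 2 / 2 ≤ y s ^ 2 / 2
      + a * Kbar a b c p * dataSize p D Θ (X 0 ^ 2 + y 0 ^ 2) * (t - s) := by
  have hK : 0 < Kbar a b c p := Kbar_pos ha (by positivity) hp (by positivity)
  have hS : 0 ≤ dataSize p D Θ (X 0 ^ 2 + y 0 ^ 2) := le_trans (by positivity) le_dataSize
  have hderiv := h.deriv_output_le ha hab hb hc hp
  generalize dataSize p D Θ (X 0 ^ 2 + y 0 ^ 2) = S at *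
  have hlin : AbsolutelyContinuousOnInterval (fun x ↦ a * Kbar a b c p * S * x) s t :=
    ContDiffOn.absolutelyContinuousOnInterval (by fun_prop)
  have hV := h.y_locallyAC.sq.div_const 2 hs.le (hs.le.trans hst) hst
  have hle := le_of_deriv_nonpos_ae hst (hV.fun_sub hlin) <| by
    filter_upwards [hderiv, h.y_differentiable] with x hx hy hxs
    have hx0 : 0 < x := hs.trans hxs.1
    rw [deriv_fun_sub (((hy hx0).fun_pow 2).div_const 2) (by fun_prop), deriv_const_mul_field,
      deriv_id'', mul_one]
    have hdiv : a * Kbar a b c p * S / (b + Real.exp (z x)) ≤ a * Kbar a b c p * S :=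
      div_le_self (by positivity) (by linarith [Real.exp_pos (z x)])
    have hcy : 0 ≤ 2 * c * (y x ^ 2 / 2) := by positivity
    linarith [hx hx0]
  linarith

theorem tendsto_excess (h : IsDADSLoop ε Γ a b c p D Θ s₁ s₂ X y z) (hε : 0 < ε) (hΓ : 0 < Γ)
    (ha : 0 < a) (hab : a ≤ b) (hb : 1 ≤ b) (hc : 1 ≤ c) (hp : 0 < p) :
    Tendsto (fun t ↦ Γ * max (y t ^ 2 / 2 - ε) 0) atTop (𝓝 0) := by
  have hK : 0 < Kbar a b c p := Kbar_pos ha (by positivity) hp (by positivity)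
  have hS : 0 ≤ dataSize p D Θ (X 0 ^ 2 + y 0 ^ 2) := le_trans (by positivity) le_dataSize
  refine tendsto_zero_of_hasDerivAt_of_le (a := 0) (F := fun t ↦ Real.exp (z t))
    (Q := Γ * (a * Kbar a b c p * dataSize p D Θ (X 0 ^ 2 + y 0 ^ 2)))
    (fun t ht ↦ h.hasDerivAt_exp_z ht) (fun t _ ↦ by positivity)
    (fun t ht ↦ h.exp_z_le hε hΓ.le ha hab hb hc hp ht.le) (by positivity) fun s hs t hst ↦ ?_
  rw [mul_assoc Γ, ← mul_add]
  have hle := h.output_le_add ha hab hb hc hp hs hst.le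
  have hQ : 0 ≤ a * Kbar a b c p * dataSize p D Θ (X 0 ^ 2 + y 0 ^ 2) * (t - s) :=
    mul_nonneg (by positivity) (sub_nonneg.2 hst.le)
  gcongr
  refine max_le ?_ (add_nonneg (le_max_right _ _) hQ)
  linarith [le_max_left (y s ^ 2 / 2 - ε) 0]

theorem eventually_abs_y_le (h : IsDADSLoop ε Γ a b c p D Θ s₁ s₂ X y z) (hε : 0 < ε) (hΓ : 0 < Γ)
    (ha : 0 < a) (hab : a ≤ b) (hb : 1 ≤ b) (hc : 1 ≤ c) (hp : 0 < p) {r : ℝ}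
    (hr : Real.sqrt (2 * ε) < r) : ∀ᶠ t in atTop, |y t| ≤ r := by
  have hr0 : 0 < r := (Real.sqrt_nonneg _).trans_lt hr
  have hr2 : 0 < Γ * (r ^ 2 / 2 - ε) := mul_pos hΓ (by linarith [(Real.sqrt_lt' hr0).1 hr])
  filter_upwards [(h.tendsto_excess hε hΓ ha hab hb hc hp).eventually (gt_mem_nhds hr2)] with t ht
  have hexc := (le_max_left _ _).trans_lt (lt_of_mul_lt_mul_left ht hΓ.le)
  exact abs_le_of_sq_le_sq (by linarith) hr0.le

theorem limsup_abs_y_le (h : IsDADSLoop ε Γ a b c p D Θ s₁ s₂ X y z) (hε : 0 < ε) (hΓ : 0 < Γ)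
    (ha : 0 < a) (hab : a ≤ b) (hb : 1 ≤ b) (hc : 1 ≤ c) (hp : 0 < p) :
    limsup (fun t ↦ |y t|) atTop ≤ Real.sqrt (2 * ε) :=
  le_of_forall_gt_imp_ge_of_dense fun _ hr ↦
    limsup_le_of_le (isCoboundedUnder_le_of_le atTop fun t ↦ abs_nonneg (y t))
      (h.eventually_abs_y_le hε hΓ ha hab hb hc hp hr)

theorem limsup_X_le (h : IsDADSLoop ε Γ a b c p D Θ s₁ s₂ X y z) (hε : 0 < ε) (hΓ : 0 < Γ)
    (ha : 0 < a) (hab : a ≤ b) (hb : 1 ≤ b) (hc : 1 ≤ c) (hp : 0 < p)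
    (hs₁ : IsBoundedUnder (· ≤ ·) atTop s₁) :
    limsup X atTop ≤ Real.sqrt (2 * ε) / (p * Real.pi ^ 2) * limsup s₁ atTop := by
  have hy : IsBoundedUnder (· ≤ ·) atTop fun t ↦ |y t| :=
    isBoundedUnder_of_eventually_le (h.eventually_abs_y_le hε hΓ ha hab hb hc hp (lt_add_one _))
  have hs₁0 : 0 ≤ limsup s₁ atTop :=
    le_limsup_of_frequently_le (Frequently.of_forall h.s₁_nonneg) hs₁
  have hs₁' : ∃ᶠ t in atTop, 0 ≤ s₁ t := Frequently.of_forall h.s₁_nonneg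
  have hy' : 0 ≤ᶠ[atTop] fun t ↦ |y t| := Eventually.of_forall fun t ↦ abs_nonneg _
  calc limsup X atTop ≤ limsup (s₁ * fun t ↦ |y t|) atTop / (p * Real.pi ^ 2) :=
        limsup_le_div_of_deriv_sq_le (by positivity) h.X_nonneg
          (LocallyACOn.of_contDiffOn h.X_sq_contDiff)
          (fun t ↦ mul_nonneg (h.s₁_nonneg t) (abs_nonneg _))
          (isBoundedUnder_le_mul_of_nonneg hs₁' hs₁ hy' hy)
          fun t ht ↦ (h.deriv_X_sq_le t ht).trans_eq (by simp only [Pi.mul_apply]; ring)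
    _ ≤ limsup s₁ atTop * limsup (fun t ↦ |y t|) atTop / (p * Real.pi ^ 2) := by
        gcongr
        exact limsup_mul_le hs₁' hs₁ hy' hy
    _ ≤ limsup s₁ atTop * Real.sqrt (2 * ε) / (p * Real.pi ^ 2) := by
        gcongr
        exact h.limsup_abs_y_le hε hΓ ha hab hb hc hp
    _ = _ := by ring

end IsDADSLoop

section EssentialBounds

variable {E : Type*} [NormedAddCommGroup E] {f : ℝ → E}

theorem ae_norm_le_supNorm (hf : MemLp f ∞ (volume.restrict (Ici (0 : ℝ)))) :
    ∀ᵐ t, 0 ≤ t → ‖f t‖ ≤ supNorm f := by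
  filter_upwards [(ae_restrict_iff' measurableSet_Ici).1 (enorm_ae_le_eLpNormEssSup f _)]
    with t hle ht
  rw [supNorm, ← toReal_enorm, eLpNorm_exponent_top]
  exact ENNReal.toReal_mono (by simpa using hf.2.ne) (hle ht)

theorem norm_le_supNorm (hf : MemLp f ∞ (volume.restrict (Ici (0 : ℝ))))
    (hcont : ContinuousOn f (Ici 0)) {t : ℝ} (ht : 0 < t) : ‖f t‖ ≤ supNorm f := by
  by_contra! hlt
  have hev : ∀ᶠ s in 𝓝 t, supNorm f < ‖f s‖ ∧ 0 < s :=
    ((hcont.continuousAt (Ici_mem_nhds ht)).norm.eventually (lt_mem_nhds hlt)).and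
      (lt_mem_nhds ht)
  refine (Measure.measure_pos_of_mem_nhds volume hev).ne'
    (measure_mono_null ?_ (ae_iff.1 (ae_norm_le_supNorm hf)))
  exact fun s hs hle ↦ (hle hs.2.le).not_gt hs.1

theorem isBoundedUnder_norm_of_memLp_top (hf : MemLp f ∞ (volume.restrict (Ici (0 : ℝ))))
    (hcont : ContinuousOn f (Ici 0)) : IsBoundedUnder (· ≤ ·) atTop fun t ↦ ‖f t‖ :=
  isBoundedUnder_of_eventually_le <|
    (eventually_gt_atTop 0).mono fun _ ht ↦ norm_le_supNorm hf hcont ht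

end EssentialBounds

namespace IsSolution

variable {ε Γ a b c p : ℝ} {K : ℝ → ℝ → ℝ} {L : H2H10 → ℝ} {d : ℝ → ℝ}
  {θ : ℝ → EuclideanSpace ℝ (Fin 2)} {w : ℝ → L2} {W : ℝ → H2H10} {y z : ℝ → ℝ}

theorem norm_deriv_w_sub_le (h : IsSolution ε Γ a b c p K L d θ w W y z)
    (hK : ∀ x ∈ Icc (0 : ℝ) 1, ∀ y : ℝ, |K x y| ≤ |y|) {t : ℝ} (ht : 0 < t) :
    ‖deriv w t - p • H2H10.dxx (W t)‖ ≤ |θ t 0| * |y t| := by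
  have hle := Lp.norm_le_of_ae_bound (f := deriv w t - p • H2H10.dxx (W t))
    (C := |θ t 0| * |y t|) (by positivity) <| by
      filter_upwards [h.w_eqn t ht, Lp.coeFn_sub (deriv w t) (p • H2H10.dxx (W t)),
        Lp.coeFn_smul p (H2H10.dxx (W t)), ae_restrict_mem measurableSet_Ioo]
        with x hw hsub hsmul hx
      rw [hsub, Pi.sub_apply, hw, hsmul, Pi.smul_apply, smul_eq_mul, add_sub_cancel_left,
        norm_mul, Real.norm_eq_abs, Real.norm_eq_abs]
      exact mul_le_mul_of_nonneg_left (hK x (Ioo_subset_Icc_self hx) _) (abs_nonneg _)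
  simpa [measureUnivNNReal] using hle

theorem deriv_norm_sq_le (h : IsSolution ε Γ a b c p K L d θ w W y z) (hp : 0 ≤ p)
    (hK : ∀ x ∈ Icc (0 : ℝ) 1, ∀ y : ℝ, |K x y| ≤ |y|) {t : ℝ} (ht : 0 < t) :
    deriv (fun t ↦ ‖w t‖ ^ 2) t ≤
      -2 * (p * Real.pi ^ 2) * ‖w t‖ ^ 2 + 2 * |θ t 0| * |y t| * ‖w t‖ := by
  have hw : HasDerivAt w (deriv w t) t :=
    ((h.w_contDiff.differentiableOn one_ne_zero).differentiableAt (Ioi_mem_nhds ht)).hasDerivAt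
  have hdiffusion := mul_le_mul_of_nonneg_left (H2H10.inner_dxx_le (W t)) hp
  rw [h.W_eq t ht] at hdiffusion
  have hsource : inner ℝ (w t) (deriv w t - p • H2H10.dxx (W t)) ≤ ‖w t‖ * (|θ t 0| * |y t|) :=
    (real_inner_le_norm _ _).trans
      (mul_le_mul_of_nonneg_left (h.norm_deriv_w_sub_le hK ht) (norm_nonneg _))
  rw [inner_sub_right, real_inner_smul_right] at hsource
  rw [hw.norm_sq.deriv]
  linarith

theorem mul_deriv_y_le (h : IsSolution ε Γ a b c p K L d θ w W y z)
    (hL : ∀ v : H2H10, |L v| ≤ ‖H2H10.toL2 v‖) (hd : MemLp d ∞ (volume.restrict (Ici (0 : ℝ)))) :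
    ∀ᵐ t, 0 < t → y t * deriv y t ≤ y t * feedback a b c (y t) (z t)
      + |θ t 1| * ‖w t‖ * |y t| + supNorm d * |y t| := by
  filter_upwards [(ae_restrict_iff' measurableSet_Ioi).1 h.y_eqn, ae_norm_le_supNorm hd]
    with t hy hdt ht
  have hLw : |L (W t)| ≤ ‖w t‖ := (hL _).trans_eq (by rw [h.W_eq t ht])
  have hcoupling : y t * (θ t 1 * L (W t)) ≤ |θ t 1| * ‖w t‖ * |y t| := by
    refine (le_abs_self _).trans ?_
    rw [abs_mul, abs_mul, mul_comm]
    gcongr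
  have hdisturbance : y t * d t ≤ supNorm d * |y t| := by
    refine (le_abs_self _).trans ?_
    rw [abs_mul, mul_comm]
    exact mul_le_mul_of_nonneg_right (hdt ht.le) (abs_nonneg _)
  rw [(hy ht).deriv]
  linarith

theorem isDADSLoop (h : IsSolution ε Γ a b c p K L d θ w W y z) (hp : 0 ≤ p)
    (hK : ∀ x ∈ Icc (0 : ℝ) 1, ∀ y : ℝ, |K x y| ≤ |y|)
    (hL : ∀ v : H2H10, |L v| ≤ ‖H2H10.toL2 v‖) (hd : MemLp d ∞ (volume.restrict (Ici (0 : ℝ))))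
    (hθ : MemLp θ ∞ (volume.restrict (Ici (0 : ℝ)))) :
    IsDADSLoop ε Γ a b c p (supNorm d) (supNorm θ) (fun t ↦ |θ t 0|) (fun t ↦ |θ t 1|)
      (fun t ↦ ‖w t‖) y z where
  X_nonneg _ := norm_nonneg _
  X_continuous := h.w_continuous.norm
  X_sq_contDiff := h.w_contDiff.norm_sq ℝ
  deriv_X_sq_le _ ht := h.deriv_norm_sq_le hp hK ht
  y_continuous := h.y_continuous
  y_locallyAC s hs t _ hst := h.y_absCont s t hs hst
  y_differentiable := by
    filter_upwards [(ae_restrict_iff' measurableSet_Ioi).1 h.y_eqn] with t hy ht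
    exact (hy ht).differentiableAt
  mul_deriv_y_le := h.mul_deriv_y_le hL hd
  z_contDiff := h.z_contDiff
  z_eqn := h.z_eqn
  s₁_nonneg _ := abs_nonneg _
  coeff_sq_le := by
    filter_upwards [ae_norm_le_supNorm hθ] with t hle ht
    calc |θ t 0| ^ 2 + |θ t 1| ^ 2 = ‖θ t‖ ^ 2 := by simp [EuclideanSpace.norm_sq_eq]
      _ ≤ supNorm θ ^ 2 := by gcongr; exact hle ht.le

end IsSolution

end DADS

theorem theorem3_general (ε Γ a b c : ℝ) (hε : 0 < ε) (hΓ : 0 < Γ) (hc : 1 ≤ c) (hb : 1 ≤ b)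
    (ha : 0 < a) (hab : a ≤ b)
    (p : ℝ) (hp : 0 < p)
    (K : ℝ → ℝ → ℝ) (hK : ∀ x ∈ Icc (0 : ℝ) 1, ∀ y : ℝ, |K x y| ≤ |y|)
    (L : DADS.H2H10 → ℝ) (hL : ∀ v : DADS.H2H10, |L v| ≤ ‖DADS.H2H10.toL2 v‖)
    (d : ℝ → ℝ) (hd : MemLp d ∞ (volume.restrict (Ici (0 : ℝ))))
    (θ : ℝ → EuclideanSpace ℝ (Fin 2)) (hθ : MemLp θ ∞ (volume.restrict (Ici (0 : ℝ))))
    (hθ₁ : IsBoundedUnder (· ≤ ·) atTop fun t ↦ |θ t 0|)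
    (w : ℝ → DADS.L2) (W : ℝ → DADS.H2H10) (y z : ℝ → ℝ)
    (hsol : DADS.IsSolution ε Γ a b c p K L d θ w W y z) :
    (∀ t ≥ 0, ‖w t‖ ^ 2 + y t ^ 2 ≤
        Real.exp (-DADS.kappa p c * t) * (‖w 0‖ ^ 2 + y 0 ^ 2)
        + 2 * a * ((DADS.supNorm d ^ 2 + DADS.supNorm θ ^ 8 + 2 * (p ^ 2)⁻¹)
            / (b * DADS.kappa p c))
        + DADS.supNorm θ ^ 4 / (2 * p ^ 2 * Real.pi ^ 4 * DADS.kappa p c)) ∧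
    (∀ t ≥ 0, z 0 ≤ z t ∧
        z t ≤ Real.log (Real.exp (z 0) + DADS.Bbar ε Γ a b c p *
          (DADS.supNorm d ^ 2 + DADS.supNorm θ ^ 4 + DADS.supNorm θ ^ 8 + 2 * (p ^ 2)⁻¹
            + ‖w 0‖ ^ 2 + y 0 ^ 2))) ∧
    limsup (fun t ↦ ‖w t‖) atTop ≤
        Real.sqrt (2 * ε) / (p * Real.pi ^ 2) * limsup (fun t ↦ |θ t 0|) atTop ∧
    limsup (fun t ↦ |y t|) atTop ≤ Real.sqrt (2 * ε) := by
  have h := hsol.isDADSLoop hp.le hK hL hd hθ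
  refine ⟨fun t ht ↦ ?_, fun t ht ↦ ⟨h.monotoneOn_z hΓ.le self_mem_Ici ht ht, ?_⟩,
    h.limsup_X_le hε hΓ ha hab hb hc hp hθ₁, h.limsup_abs_y_le hε hΓ ha hab hb hc hp⟩
  · rw [add_assoc]
    exact (h.energy_le ha hab hb hc hp ht).trans (add_le_add_right
      (DADS.residualEnergy_le ha.le (by positivity) hp (by positivity)) _)
  · have hz := h.exp_z_le hε hΓ.le ha hab hb hc hp ht
    rw [DADS.dataSize, ← add_assoc] at hz
    exact (Real.le_log_iff_exp_le ((Real.exp_pos _).trans_le hz)).2 hz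

theorem theorem3 (ε Γ a b c : ℝ) (hε : 0 < ε) (hΓ : 0 < Γ) (hc : 1 ≤ c) (hb : 1 ≤ b)
    (ha : 0 < a) (ha1 : a ≤ 1)
    (p : ℝ) (hp : 0 < p)
    (K : ℝ → ℝ → ℝ) (hK : ∀ x ∈ Icc (0 : ℝ) 1, ∀ y : ℝ, |K x y| ≤ |y|)
    (L : DADS.H2H10 → ℝ) (hL : ∀ v : DADS.H2H10, |L v| ≤ ‖DADS.H2H10.toL2 v‖)
    (d : ℝ → ℝ) (hd : MemLp d ∞ (volume.restrict (Ici (0 : ℝ))))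
    (θ : ℝ → EuclideanSpace ℝ (Fin 2)) (hθc : ContinuousOn θ (Ici 0))
    (hθ : MemLp θ ∞ (volume.restrict (Ici (0 : ℝ))))
    (w : ℝ → DADS.L2) (W : ℝ → DADS.H2H10) (y z : ℝ → ℝ)
    (hsol : DADS.IsSolution ε Γ a b c p K L d θ w W y z) :
    (∀ t ≥ 0, ‖w t‖ ^ 2 + y t ^ 2 ≤
        Real.exp (-DADS.kappa p c * t) * (‖w 0‖ ^ 2 + y 0 ^ 2)
        + 2 * a * ((DADS.supNorm d ^ 2 + DADS.supNorm θ ^ 8 + 2 * (p ^ 2)⁻¹)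
            / (b * DADS.kappa p c))
        + DADS.supNorm θ ^ 4 / (2 * p ^ 2 * Real.pi ^ 4 * DADS.kappa p c)) ∧
    (∀ t ≥ 0, z 0 ≤ z t ∧
        z t ≤ Real.log (Real.exp (z 0) + DADS.Bbar ε Γ a b c p *
          (DADS.supNorm d ^ 2 + DADS.supNorm θ ^ 4 + DADS.supNorm θ ^ 8 + 2 * (p ^ 2)⁻¹
            + ‖w 0‖ ^ 2 + y 0 ^ 2))) ∧
    limsup (fun t => ‖w t‖) atTop ≤
        Real.sqrt (2 * ε) / (p * Real.pi ^ 2) * limsup (fun t => |θ t 0|) atTop ∧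
    limsup (fun t => |y t|) atTop ≤ Real.sqrt (2 * ε) := by
  exact theorem3_general ε Γ a b c hε hΓ hc hb ha (ha1.trans hb) p hp K hK L hL d hd θ hθ
    ((DADS.isBoundedUnder_norm_of_memLp_top hθ hθc).mono_le
      (.of_forall fun t ↦ PiLp.norm_apply_le (θ t) 0)) w W y z hsol
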